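/- Let $\mathcal H,\mathcal F,\mathcal Y$ be real Hilbert spaces, let $L:\mathcal D(L)\subset\mathcal H\to\mathcal F$ be a closed, densely defined linear operator and let $H:\mathcal H\to\mathcal Y$ be a bounded linear operator. An unknown $\varphi\in\mathcal D(L)$ satisfies $L\varphi\in\mathcal G_1=\{f\in\mathcal F:(f,f)\le 1\}$ and is observed through $y=H\varphi+\eta$, where $\eta$ is a random vector in $\mathcal Y$ with zero mean and $M(\eta,\eta)\le 1$ ($M$ denotes expectation). For $\ell\in\mathcal H$, $u\in\mathcal Y$, $c\in\mathbb R$ let $$\sigma(\ell;u,c)=\sup_{\varphi,\eta} M\big((\ell,\varphi)-(u,y)-c\big)^2\in[0,\infty],$$ the supremum being over all such $\varphi$ and all such $\eta$. An estimate $y\mapsto(\hat u,y)+\hat c$ is called minimax in the direction $\ell$ if $\sigma(\ell;\hat u,\hat c)=\inf_{u,c}\sigma(\ell;u,c)$, and $\hat\sigma(\ell)=\big(\inf_{u,c}\sigma(\ell;u,c)\big)^{1/2}$ is the minimax error. Suppose that at least one of the following holds: 1) $R(L)$ and $H(N(L))$ are closed, where $R(L)$ is the range and $N(L)$ the null space of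 $L$; 2) $R(T)=\{[Lx,Hx]:x\in\mathcal D(L)\}$ is closed in $\mathcal F\times\mathcal Y$. Then for every $\ell\in\mathcal H$ the following three conditions are each equivalent to $\ell\in R(L^*)+R(H^*)$: the minimax error $\hat\sigma(\ell)$ is finite; there is exactly one minimax estimate $(\hat u,\hat c)$; the system $$L^*\hat z=\ell-H^*H\hat p,\qquad L\hat p=\hat z$$ has a solution $\hat z\in\mathcal D(L^*)$, $\hat p\in\mathcal D(L)$. Moreover, for any solution $(\hat z,\hat p)$ of this system the unique minimax estimate is given by $\hat u=H\hat p$, $\hat c=0$; furthermore $(\ell,\hat p)\ge 0$ and $\hat\sigma(\ell)=(\ell,\hat p)^{1/2}$. -/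

import Mathlib

open MeasureTheory
open scoped ENNReal RealInnerProductSpace

noncomputable section

namespace MinimaxEstimation

variable {E F Y : Type*}
  [NormedAddCommGroup E] [InnerProductSpace ℝ E] [CompleteSpace E]
  [NormedAddCommGroup F] [InnerProductSpace ℝ F] [CompleteSpace F]
  [NormedAddCommGroup Y] [InnerProductSpace ℝ Y] [CompleteSpace Y]

/-- `μ` is the distribution of a square-integrable random vector `η` in `Y` with zero mean and
`M (η, η) ≤ 1`. -/
def IsAdmissibleNoise [MeasurableSpace Y] (μ : Measure Y) : Prop :=
  IsProbabilityMeasure μ ∧ MemLp (fun η : Y => η) 2 μ ∧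
    ∫ η, η ∂μ = 0 ∧ ∫ η, ⟪η, η⟫ ∂μ ≤ 1

/-- The worst-case mean-squared error of the affine estimate `y ↦ (u, y) + c` of `(ℓ, φ)`
from the observation `y = H φ + η`: the supremum of `M ((ℓ, φ) - (u, y) - c) ^ 2` over all
`φ ∈ D(L)` with `L φ ∈ G` and all admissible noise distributions. -/
def worstCaseError [MeasurableSpace Y] (L : E →ₗ.[ℝ] F) (H : E →L[ℝ] Y) (G : Set F)
    (ℓ : E) (u : Y) (c : ℝ) : ℝ≥0∞ :=
  ⨆ (φ : L.domain) (_ : L φ ∈ G) (μ : Measure Y) (_ : IsAdmissibleNoise μ),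
    ∫⁻ η, ENNReal.ofReal ((⟪ℓ, (φ : E)⟫ - (⟪u, H φ + η⟫ + c)) ^ 2) ∂μ

/-- `y ↦ (u, y) + c` is an a priori minimax mean-squared estimate in the direction `ℓ`. -/
def IsMinimaxEstimate [MeasurableSpace Y] (L : E →ₗ.[ℝ] F) (H : E →L[ℝ] Y) (G : Set F)
    (ℓ : E) (u : Y) (c : ℝ) : Prop :=
  worstCaseError L H G ℓ u c = ⨅ (v : Y) (d : ℝ), worstCaseError L H G ℓ v d

/-- The minimax mean-squared error in the direction `ℓ` (a square root; it may be infinite). -/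
def minimaxError [MeasurableSpace Y] (L : E →ₗ.[ℝ] F) (H : E →L[ℝ] Y) (G : Set F)
    (ℓ : E) : ℝ≥0∞ :=
  (⨅ (v : Y) (d : ℝ), worstCaseError L H G ℓ v d) ^ (1 / 2 : ℝ)

/-- The range `R(L)`. -/
def rangeL (L : E →ₗ.[ℝ] F) : Set F := Set.range fun x : L.domain => L x

/-- The image `H(N(L))` of the null space of `L`. -/
def imageKer (L : E →ₗ.[ℝ] F) (H : E →L[ℝ] Y) : Set Y :=
  (fun x : L.domain => H x) '' {x | L x = 0}

/-- `R(T) = {[L x, H x] : x ∈ D(L)}`. -/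
def rangeT (L : E →ₗ.[ℝ] F) (H : E →L[ℝ] Y) : Set (F × Y) :=
  Set.range fun x : L.domain => (L x, H x)

/-- `R(L*) + R(H*)`. -/
def sumRangeAdjoint (L : E →ₗ.[ℝ] F) (H : E →L[ℝ] Y) : Set E :=
  {ℓ | ∃ (z : L.adjoint.domain) (u : Y), ℓ = L.adjoint z + H.adjoint u}

/-- `z ∈ D(L*)` and `p ∈ D(L)` solve `L* z = ℓ - H* H p`, `L p = z`. -/
def IsEulerSolution (L : E →ₗ.[ℝ] F) (H : E →L[ℝ] Y) (ℓ : E) (z : F) (p : E) : Prop :=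
  ∃ (hz : z ∈ L.adjoint.domain) (hp : p ∈ L.domain),
    L.adjoint ⟨z, hz⟩ = ℓ - H.adjoint (H p) ∧ L ⟨p, hp⟩ = z

end MinimaxEstimation

end

/-! Zero mean removes the cross term, so the worst noise adds exactly `‖u‖ ^ 2`, attained by a
random sign along `u` (`worstCaseError_eq`). By symmetry and scaling in `φ`, a finite error forces
`φ ↦ (ℓ - H* u, φ)` to be dominated by `‖L φ‖`; Hahn–Banach and Riesz then give `ℓ - H* u ∈ R(L*)`.
If `R(T)` is closed and `ℓ = L* z₀ + H* u₀`, projecting `(z₀, u₀)` orthogonally onto `R(T)` gives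
`(L p, H p)`, and orthogonality is the Euler system. Testing any estimate against `φ = p` shows that
its error exceeds `(ℓ, p)` by at least `‖u - H p‖ ^ 2 + c ^ 2`
(`IsEulerSolution.le_of_worstCaseError_le`), which yields both optimality and uniqueness. -/

namespace MinimaxEstimation

/-! ### Extremal noise distributions. -/

section Noise

variable {Y : Type*} [NormedAddCommGroup Y] [InnerProductSpace ℝ Y]
  [MeasurableSpace Y]

theorem IsAdmissibleNoise.lintegral_le [CompleteSpace Y] {μ : Measure Y}
    (hμ : IsAdmissibleNoise μ) (u : Y) (b : ℝ) :
    ∫⁻ η, ENNReal.ofReal ((b - ⟪u, η⟫) ^ 2) ∂μ ≤ ENNReal.ofReal (b ^ 2 + ‖u‖ ^ 2) := by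
  obtain ⟨hprob, hL2, hmean, hvar⟩ := hμ
  have hint : Integrable (fun η : Y => η) μ := hL2.integrable (by norm_num)
  have hlin : Integrable (fun η : Y => ⟪u, η⟫) μ := hint.const_inner u
  have hlin2 : MemLp (fun η : Y => ⟪u, η⟫) 2 μ := hL2.const_inner u
  have hsq : Integrable (fun η : Y => ⟪u, η⟫ ^ 2) μ := hlin2.integrable_sq
  have hnsq : Integrable (fun η : Y => ‖η‖ ^ 2) μ := hL2.norm.integrable_sq
  have hzero : ∫ η, ⟪u, η⟫ ∂μ = 0 := by
    rw [integral_inner hint, hmean, inner_zero_right]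
  have hbound : ∫ η, ⟪u, η⟫ ^ 2 ∂μ ≤ ‖u‖ ^ 2 := by
    calc ∫ η, ⟪u, η⟫ ^ 2 ∂μ ≤ ∫ η, ‖u‖ ^ 2 * ‖η‖ ^ 2 ∂μ := by
          refine integral_mono hsq (hnsq.const_mul _) fun η => ?_
          have := abs_real_inner_le_norm u η
          simpa [mul_pow, sq_abs] using pow_le_pow_left₀ (abs_nonneg _) this 2
      _ = ‖u‖ ^ 2 * ∫ η, ⟪η, η⟫ ∂μ := by
          rw [integral_const_mul]; simp only [real_inner_self_eq_norm_sq]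
      _ ≤ ‖u‖ ^ 2 := mul_le_of_le_one_right (sq_nonneg _) hvar
  have hexp : (fun η : Y => (b - ⟪u, η⟫) ^ 2)
      = fun η => (b ^ 2 - 2 * b * ⟪u, η⟫) + ⟪u, η⟫ ^ 2 := by
    funext η; ring
  have hi1 : Integrable (fun η : Y => b ^ 2 - 2 * b * ⟪u, η⟫) μ :=
    (integrable_const _).sub (hlin.const_mul _)
  have hi : Integrable (fun η : Y => (b - ⟪u, η⟫) ^ 2) μ := by
    rw [hexp]; exact hi1.add hsq
  rw [← ofReal_integral_eq_lintegral_ofReal hi (ae_of_all _ fun η => sq_nonneg _)]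
  refine ENNReal.ofReal_le_ofReal ?_
  rw [hexp, integral_add hi1 hsq, integral_sub (integrable_const _) (hlin.const_mul _),
    integral_const_mul, hzero]
  simpa using hbound

/-- The distribution of a random sign times `v`. -/
noncomputable def signNoise (v : Y) : Measure Y :=
  (2⁻¹ : ℝ≥0∞) • (Measure.dirac v + Measure.dirac (-v))

theorem isAdmissibleNoise_signNoise [BorelSpace Y] [CompleteSpace Y] {v : Y} (hv : ‖v‖ ≤ 1) :
    IsAdmissibleNoise (signNoise v) := by
  have hprob : IsProbabilityMeasure (signNoise v) := ⟨by
    simp [signNoise, ENNReal.inv_two_add_inv_two]⟩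
  have hi (w : Y) : Integrable (fun η : Y => η) (Measure.dirac w) := integrable_dirac (by simp)
  have hi2 (w : Y) : Integrable (fun η : Y => ⟪η, η⟫) (Measure.dirac w) :=
    integrable_dirac (by simp)
  refine ⟨hprob, ?_, ?_, ?_⟩
  · refine MemLp.of_bound (C := 1) ?_ ?_
    · exact ((hi v).add_measure (hi (-v))).aestronglyMeasurable.smul_measure _
    · refine Measure.ae_smul_measure ?_ _
      rw [ae_add_measure_iff]
      simp [ae_dirac_eq, hv]
  · rw [signNoise, integral_smul_measure, integral_add_measure (hi _) (hi _)]
    simp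
  · rw [signNoise, integral_smul_measure, integral_add_measure (hi2 _) (hi2 _)]
    simp only [integral_dirac, real_inner_self_eq_norm_sq]
    have : ‖v‖ ^ 2 ≤ 1 := pow_le_one₀ (norm_nonneg _) hv
    simp; linarith

/-- Equality case of the bound `IsAdmissibleNoise.lintegral_le`. For `u = 0` the direction `‖u‖⁻¹ •
u` is `0`, and the formula still holds. -/
theorem lintegral_signNoise [BorelSpace Y] (u : Y) (b : ℝ) :
    ∫⁻ η, ENNReal.ofReal ((b - ⟪u, η⟫) ^ 2) ∂(signNoise (‖u‖⁻¹ • u)) =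
      ENNReal.ofReal (b ^ 2 + ‖u‖ ^ 2) := by
  have hu : ⟪u, ‖u‖⁻¹ • u⟫ = ‖u‖ := by
    rw [inner_smul_right, real_inner_self_eq_norm_sq]
    by_cases h : ‖u‖ = 0
    · simp [h]
    · field_simp
  rw [signNoise, lintegral_smul_measure, lintegral_add_measure, lintegral_dirac, lintegral_dirac,
    inner_neg_right, hu, ← ENNReal.ofReal_add (sq_nonneg _) (sq_nonneg _), smul_eq_mul,
    show (2⁻¹ : ℝ≥0∞) = ENNReal.ofReal (2⁻¹) by simp [ENNReal.ofReal_inv_of_pos],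
    ← ENNReal.ofReal_mul (by norm_num)]
  congr 1
  ring

end Noise

/-! ### Functionals dominated by `L`, and closedness of `R(T)`. -/

section Estimation

variable {E F Y : Type*}
  [NormedAddCommGroup E] [InnerProductSpace ℝ E] [CompleteSpace E]
  [NormedAddCommGroup F] [InnerProductSpace ℝ F]
  [NormedAddCommGroup Y] [InnerProductSpace ℝ Y]

/-- A functional dominated by `‖L φ‖` is of the form `φ ↦ (L* z, φ)`. -/
theorem exists_adjoint_eq_of_inner_le [CompleteSpace F] {L : E →ₗ.[ℝ] F}
    (hLd : Dense (L.domain : Set E)) {w : E} {C : ℝ}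
    (h : ∀ φ : L.domain, |⟪w, (φ : E)⟫| ≤ C * ‖L φ‖) :
    ∃ z : L.adjoint.domain, L.adjoint z = w := by
  have hker : LinearMap.ker L.toFun ≤ LinearMap.ker ((innerₛₗ ℝ w).comp L.domain.subtype) := by
    intro φ hφ
    have hφ' : L φ = 0 := hφ
    have := h φ
    rw [hφ', norm_zero, mul_zero] at this
    exact abs_nonpos_iff.mp this
  -- The functional vanishes on `N(L)`, so it factors through `L` as a bounded functional on `R(L)`,
  -- extended below to all of `F`.
  let g : LinearMap.range L.toFun →ₗ[ℝ] ℝ :=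
    ((LinearMap.ker L.toFun).liftQ _ hker).comp
      (L.toFun.quotKerEquivRange.symm : LinearMap.range L.toFun →ₗ[ℝ] _)
  have hg (φ : L.domain) : g ⟨L φ, φ, rfl⟩ = ⟪w, (φ : E)⟫ := by
    have : L.toFun.quotKerEquivRange.symm ⟨L φ, φ, rfl⟩ = (LinearMap.ker L.toFun).mkQ φ :=
      (LinearEquiv.symm_apply_eq _).2 (Subtype.ext rfl)
    simp only [g, LinearMap.comp_apply, LinearEquiv.coe_coe, this]
    rfl
  have hgb (x : LinearMap.range L.toFun) : ‖g x‖ ≤ C * ‖x‖ := by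
    obtain ⟨_, φ, rfl⟩ := x
    exact (congrArg norm (hg φ)).trans_le (h φ)
  obtain ⟨G, hG, -⟩ := exists_extension_norm_eq (LinearMap.range L.toFun)
    (g.mkContinuous C hgb)
  have hz (φ : L.domain) : ⟪w, (φ : E)⟫ = ⟪(InnerProductSpace.toDual ℝ F).symm G, L φ⟫ := by
    rw [InnerProductSpace.toDual_symm_apply, ← hg φ]
    exact (hG ⟨L φ, φ, rfl⟩).symm
  have hmem := LinearPMap.mem_adjoint_domain_of_exists (T := L) _ ⟨w, hz⟩
  exact ⟨⟨_, hmem⟩, LinearPMap.adjoint_apply_eq hLd _ hz⟩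

/-- Open mapping theorem for the projection of the graph of `L` onto `R(L)`; both spaces are
complete because they are closed. -/
theorem exists_mem_domain_norm_le [CompleteSpace F] {L : E →ₗ.[ℝ] F} (hLc : L.IsClosed)
    (hR : IsClosed (rangeL L)) :
    ∃ C : ℝ, ∀ f ∈ rangeL L, ∃ x : L.domain, L x = f ∧ ‖(x : E)‖ ≤ C * ‖f‖ := by
  have hgc : CompleteSpace L.graph := IsClosed.completeSpace_coe (hs := hLc)
  have hrc : CompleteSpace (LinearMap.range L.toFun) :=
    IsClosed.completeSpace_coe (hs := by
      have : ((LinearMap.range L.toFun : Submodule ℝ F) : Set F) = rangeL L := rfl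
      rwa [this])
  let S : L.graph →L[ℝ] LinearMap.range L.toFun :=
    ((ContinuousLinearMap.snd ℝ E F).comp L.graph.subtypeL).codRestrict _ (by
      rintro ⟨a, ha⟩
      obtain ⟨y, -, hy⟩ := (LinearPMap.mem_graph_iff L).1 ha
      exact ⟨y, hy⟩)
  have hS : Function.Surjective S := by
    rintro ⟨_, φ, rfl⟩
    exact ⟨⟨((φ : E), L φ), L.mem_graph φ⟩, Subtype.ext rfl⟩
  obtain ⟨C, -, hC⟩ := S.exists_preimage_norm_le hS
  refine ⟨C, fun f hf => ?_⟩
  obtain ⟨⟨a, ha⟩, hx, hn⟩ := hC ⟨f, hf⟩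
  obtain ⟨y, hy1, hy2⟩ := (LinearPMap.mem_graph_iff L).1 ha
  have haf : a.2 = f := congrArg Subtype.val hx
  refine ⟨y, hy2.trans haf, ?_⟩
  rw [hy1]
  exact (norm_fst_le a).trans hn

theorem isClosed_rangeT_of_isClosed_rangeL [CompleteSpace F] {L : E →ₗ.[ℝ] F}
    (hLc : L.IsClosed) (H : E →L[ℝ] Y) (hR : IsClosed (rangeL L))
    (hK : IsClosed (imageKer L H)) : IsClosed (rangeT L H) := by
  obtain ⟨C, hC⟩ := exists_mem_domain_norm_le hLc hR
  refine isClosed_of_closure_subset fun ⟨f, y⟩ hfy => ?_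
  obtain ⟨t, ht, hlim⟩ := mem_closure_iff_seq_limit.1 hfy
  choose x hx using ht
  obtain ⟨hlimL, hlimH⟩ := (Prod.tendsto_iff _ _).1 hlim
  have htx (n : ℕ) : t n = (L (x n), H (x n)) := (hx n).symm
  simp only [htx] at hlimL hlimH
  obtain ⟨x₀, hx₀⟩ : f ∈ rangeL L :=
    hR.mem_of_tendsto hlimL (Filter.Eventually.of_forall fun n => ⟨x n, rfl⟩)
  simp only at hx₀
  -- Small preimages `d n → 0` correct `x n - x₀` to elements of `N(L)` without changing the limit
  -- of their images under `H`.
  choose d hdL hdn using fun n => hC (L (x n - x₀)) ⟨_, rfl⟩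
  have hd : Filter.Tendsto (fun n => ((d n : L.domain) : E)) Filter.atTop (nhds 0) := by
    refine squeeze_zero_norm hdn ?_
    have : Filter.Tendsto (fun n => L (x n) - f) Filter.atTop (nhds 0) := by
      simpa using hlimL.sub_const f
    simpa [LinearPMap.map_sub, hx₀] using this.norm.const_mul C
  have hlimK : Filter.Tendsto (fun n => H ((x n - x₀ - d n : L.domain) : E)) Filter.atTop
      (nhds (y - H x₀)) := by
    have := (hlimH.sub_const (H (x₀ : E))).sub ((H.continuous.tendsto 0).comp hd)
    simpa [Function.comp_def] using this
  obtain ⟨k, hk, hHk⟩ : y - H x₀ ∈ imageKer L H :=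
    hK.mem_of_tendsto hlimK (Filter.Eventually.of_forall fun n =>
      ⟨x n - x₀ - d n, by
        rw [Set.mem_ofPred_eq, LinearPMap.map_sub, hdL, sub_self], rfl⟩)
  refine ⟨x₀ + k, ?_⟩
  have hk' : L k = 0 := hk
  simp only at hHk
  simp [LinearPMap.map_add, hk', hx₀, hHk]

variable [CompleteSpace Y]

/-! ### The worst-case error as a deterministic supremum. -/

theorem worstCaseError_eq [MeasurableSpace Y] [BorelSpace Y]
    (L : E →ₗ.[ℝ] F) (H : E →L[ℝ] Y) (G : Set F) (ℓ : E) (u : Y) (c : ℝ) :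
    worstCaseError L H G ℓ u c = ⨆ (φ : L.domain) (_ : L φ ∈ G),
      ENNReal.ofReal ((⟪ℓ - H.adjoint u, (φ : E)⟫ - c) ^ 2 + ‖u‖ ^ 2) := by
  unfold worstCaseError
  refine iSup_congr fun φ => iSup_congr fun _ => ?_
  have hform (η : Y) : ⟪ℓ, (φ : E)⟫ - (⟪u, H φ + η⟫ + c)
      = (⟪ℓ - H.adjoint u, (φ : E)⟫ - c) - ⟪u, η⟫ := by
    rw [inner_sub_left, ContinuousLinearMap.adjoint_inner_left, inner_add_right]; ring
  simp only [hform]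
  refine le_antisymm (iSup₂_le fun μ hμ => hμ.lintegral_le u _) ?_
  rw [← lintegral_signNoise]
  refine le_iSup₂_of_le (signNoise (‖u‖⁻¹ • u)) (isAdmissibleNoise_signNoise ?_) le_rfl
  rw [norm_smul, norm_inv, norm_norm]
  exact inv_mul_le_one

theorem worstCaseError_le_iff [MeasurableSpace Y] [BorelSpace Y]
    (L : E →ₗ.[ℝ] F) (H : E →L[ℝ] Y) (ℓ : E) (u : Y) (c : ℝ) {s : ℝ} (hs : 0 ≤ s) :
    worstCaseError L H {f : F | ⟪f, f⟫ ≤ 1} ℓ u c ≤ ENNReal.ofReal s ↔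
      ∀ φ : L.domain, ‖L φ‖ ≤ 1 → (⟪ℓ - H.adjoint u, (φ : E)⟫ - c) ^ 2 + ‖u‖ ^ 2 ≤ s := by
  rw [worstCaseError_eq]
  simp only [iSup_le_iff, ENNReal.ofReal_le_ofReal_iff hs, Set.mem_ofPred_eq,
    real_inner_self_eq_norm_sq, sq_le_one_iff₀ (norm_nonneg _)]

/-- By symmetry and homogeneity in `φ`, a bound for the worst-case error bounds the functional
`φ ↦ (ℓ - H* u, φ)` in terms of `L φ`. -/
theorem inner_sq_le_of_worstCaseError_le [MeasurableSpace Y] [BorelSpace Y]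
    {L : E →ₗ.[ℝ] F} {H : E →L[ℝ] Y} {ℓ : E} {u : Y} {c s : ℝ} (hs : 0 ≤ s)
    (h : worstCaseError L H {f : F | ⟪f, f⟫ ≤ 1} ℓ u c ≤ ENNReal.ofReal s) (φ : L.domain) :
    ⟪ℓ - H.adjoint u, (φ : E)⟫ ^ 2 ≤ (s - c ^ 2 - ‖u‖ ^ 2) * ‖L φ‖ ^ 2 := by
  rw [worstCaseError_le_iff L H ℓ u c hs] at h
  set w := ℓ - H.adjoint u
  have hball (ψ : L.domain) (hψ : ‖L ψ‖ ≤ 1) :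
      ⟪w, (ψ : E)⟫ ^ 2 ≤ s - c ^ 2 - ‖u‖ ^ 2 := by
    have h1 := h ψ hψ
    -- Averaging the bounds at `ψ` and `-ψ` cancels the term linear in `c`.
    have h2 := h (-ψ) (by rwa [LinearPMap.map_neg, norm_neg])
    rw [NegMemClass.coe_neg, inner_neg_right] at h2
    linarith
  have hscale (r : ℝ) (hr : r * ‖L φ‖ ≤ 1) (hr0 : 0 ≤ r) :
      r ^ 2 * ⟪w, (φ : E)⟫ ^ 2 ≤ s - c ^ 2 - ‖u‖ ^ 2 := by
    have := hball (r • φ) (by rwa [LinearPMap.map_smul, norm_smul, Real.norm_of_nonneg hr0])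
    rwa [SetLike.val_smul, inner_smul_right, mul_pow] at this
  by_cases hL : ‖L φ‖ = 0
  · have h0 : ⟪w, (φ : E)⟫ = 0 := by
      by_contra hne
      have hpos : 0 < ⟪w, (φ : E)⟫ ^ 2 := by positivity
      have hB : 0 ≤ s - c ^ 2 - ‖u‖ ^ 2 := by simpa using hscale 0 (by simp) le_rfl
      -- When `L φ = 0` every scaling is allowed; this one makes the left side equal to the bound
      -- plus one.
      have := hscale √((s - c ^ 2 - ‖u‖ ^ 2 + 1) / ⟪w, (φ : E)⟫ ^ 2) (by simp [hL])
        (Real.sqrt_nonneg _)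
      rw [Real.sq_sqrt (by positivity), div_mul_cancel₀ _ hpos.ne'] at this
      linarith
    simp [h0, hL]
  · have hpos : 0 < ‖L φ‖ := lt_of_le_of_ne (norm_nonneg _) (Ne.symm hL)
    have := hscale ‖L φ‖⁻¹ (inv_mul_cancel₀ hL).le (by positivity)
    rwa [inv_pow, inv_mul_le_iff₀ (by positivity), mul_comm] at this

/-! ### The Euler system and optimality of its solution. -/

theorem exists_isEulerSolution_of_mem_sumRangeAdjoint [CompleteSpace F] {L : E →ₗ.[ℝ] F}
    (hLd : Dense (L.domain : Set E)) {H : E →L[ℝ] Y} (hT : IsClosed (rangeT L H)) {ℓ : E}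
    (hℓ : ℓ ∈ sumRangeAdjoint L H) : ∃ (z : F) (p : E), IsEulerSolution L H ℓ z p := by
  obtain ⟨z₀, u₀, rfl⟩ := hℓ
  -- `WithLp 2` supplies the Hilbert structure needed for orthogonal projection; the plain product
  -- carries the sup norm.
  let T : L.domain →ₗ[ℝ] WithLp 2 (F × Y) :=
    (WithLp.linearEquiv 2 ℝ (F × Y)).symm.toLinearMap.comp
      (L.toFun.prod (H.toLinearMap.comp L.domain.subtype))
  have hTapp (φ : L.domain) : T φ = WithLp.toLp 2 (L φ, H φ) := rfl
  have hTc : IsClosed ((LinearMap.range T : Submodule ℝ _) : Set (WithLp 2 (F × Y))) := by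
    have : ((LinearMap.range T : Submodule ℝ _) : Set (WithLp 2 (F × Y)))
        = WithLp.ofLp ⁻¹' rangeT L H := by
      ext a
      constructor
      · rintro ⟨φ, rfl⟩
        exact ⟨φ, rfl⟩
      · rintro ⟨φ, hφ⟩
        exact ⟨φ, congrArg (WithLp.toLp 2) hφ⟩
    rw [this]
    exact hT.preimage (WithLp.prod_continuous_ofLp 2 F Y)
  have : CompleteSpace (LinearMap.range T) := hTc.completeSpace_coe
  obtain ⟨_, ⟨p, rfl⟩, hp⟩ := (LinearMap.range T).exists_norm_eq_iInf_of_complete_subspace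
    hTc.isComplete (WithLp.toLp 2 ((z₀ : F), u₀))
  rw [(LinearMap.range T).norm_eq_iInf_iff_real_inner_eq_zero ⟨p, rfl⟩] at hp
  have hz (φ : L.domain) :
      ⟪L.adjoint z₀ + H.adjoint u₀ - H.adjoint (H p), (φ : E)⟫ = ⟪L p, L φ⟫ := by
    have h1 := hp (T φ) ⟨φ, rfl⟩
    rw [hTapp, hTapp, WithLp.prod_inner_apply] at h1
    simp only [WithLp.ofLp_sub, Prod.fst_sub, Prod.snd_sub, inner_sub_left] at h1
    rw [inner_sub_left, inner_add_left, ContinuousLinearMap.adjoint_inner_left,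
      ContinuousLinearMap.adjoint_inner_left, LinearPMap.adjoint_isFormalAdjoint hLd z₀ φ]
    linarith
  have hmem := LinearPMap.mem_adjoint_domain_of_exists (T := L) (L p) ⟨_, hz⟩
  exact ⟨L p, p, hmem, p.2, LinearPMap.adjoint_apply_eq hLd _ hz, rfl⟩

theorem IsEulerSolution.mem_sumRangeAdjoint [CompleteSpace F] {L : E →ₗ.[ℝ] F}
    {H : E →L[ℝ] Y} {ℓ : E} {z : F} {p : E} (h : IsEulerSolution L H ℓ z p) :
    ℓ ∈ sumRangeAdjoint L H := by
  obtain ⟨hz, -, h, -⟩ := h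
  exact ⟨⟨z, hz⟩, H p, by rw [h, sub_add_cancel]⟩

theorem IsEulerSolution.inner_eq {L : E →ₗ.[ℝ] F} (hLd : Dense (L.domain : Set E))
    {H : E →L[ℝ] Y} {ℓ : E} {z : F} {p : E} (h : IsEulerSolution L H ℓ z p) (φ : L.domain) :
    ⟪ℓ, (φ : E)⟫ = ⟪z, L φ⟫ + ⟪H p, H φ⟫ := by
  obtain ⟨hz, -, h, -⟩ := h
  have h1 := LinearPMap.adjoint_isFormalAdjoint hLd ⟨z, hz⟩ φ
  rw [h, inner_sub_left, ContinuousLinearMap.adjoint_inner_left] at h1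
  exact sub_eq_iff_eq_add.1 h1

theorem IsEulerSolution.inner_self_eq {L : E →ₗ.[ℝ] F} (hLd : Dense (L.domain : Set E))
    {H : E →L[ℝ] Y} {ℓ : E} {z : F} {p : E} (h : IsEulerSolution L H ℓ z p) :
    ⟪ℓ, p⟫ = ‖z‖ ^ 2 + ‖H p‖ ^ 2 := by
  have h1 := h.inner_eq hLd
  obtain ⟨-, hp, -, hLp⟩ := h
  rw [h1 ⟨p, hp⟩, hLp, real_inner_self_eq_norm_sq, real_inner_self_eq_norm_sq]

theorem IsEulerSolution.worstCaseError_le [MeasurableSpace Y] [BorelSpace Y]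
    {L : E →ₗ.[ℝ] F} (hLd : Dense (L.domain : Set E))
    {H : E →L[ℝ] Y} {ℓ : E} {z : F} {p : E} (h : IsEulerSolution L H ℓ z p) :
    worstCaseError L H {f : F | ⟪f, f⟫ ≤ 1} ℓ (H p) 0 ≤ ENNReal.ofReal ⟪ℓ, p⟫ := by
  have hs := h.inner_self_eq hLd
  rw [worstCaseError_le_iff L H ℓ _ _ (by rw [hs]; positivity), hs]
  intro φ hφ
  rw [inner_sub_left, ContinuousLinearMap.adjoint_inner_left, h.inner_eq hLd, add_sub_cancel_right,
    sub_zero]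
  have h1 : |⟪z, L φ⟫| ≤ ‖z‖ :=
    (abs_real_inner_le_norm _ _).trans (mul_le_of_le_one_right (norm_nonneg _) hφ)
  have := pow_le_pow_left₀ (abs_nonneg _) h1 2
  rw [sq_abs] at this
  linarith

/-- With `B = s - c ^ 2 - ‖u‖ ^ 2`, testing at `p` gives `(ℓ - H* u, p) ≤ √B ‖z‖ ≤ (B + ‖z‖ ^ 2) /
2`; substituting `(ℓ, p) = ‖z‖ ^ 2 + ‖H p‖ ^ 2` completes the square in `u - H p`. -/
theorem IsEulerSolution.le_of_worstCaseError_le [MeasurableSpace Y] [BorelSpace Y]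
    {L : E →ₗ.[ℝ] F} (hLd : Dense (L.domain : Set E))
    {H : E →L[ℝ] Y} {ℓ : E} {z : F} {p : E} (h : IsEulerSolution L H ℓ z p) {u : Y} {c s : ℝ}
    (hs : 0 ≤ s) (hle : worstCaseError L H {f : F | ⟪f, f⟫ ≤ 1} ℓ u c ≤ ENNReal.ofReal s) :
    ⟪ℓ, p⟫ + ‖u - H p‖ ^ 2 + c ^ 2 ≤ s := by
  have hself := h.inner_self_eq hLd
  obtain ⟨-, hp, -, hLp⟩ := h
  have h0 := (worstCaseError_le_iff L H ℓ u c hs).1 hle 0 (by simp)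
  have hB : 0 ≤ s - c ^ 2 - ‖u‖ ^ 2 := by
    simp only [ZeroMemClass.coe_zero, inner_zero_right] at h0
    linarith
  have h1 := inner_sq_le_of_worstCaseError_le hs hle ⟨p, hp⟩
  rw [hLp, inner_sub_left, ContinuousLinearMap.adjoint_inner_left] at h1
  have h2 : ⟪ℓ, p⟫ - ⟪u, H p⟫ ≤ √(s - c ^ 2 - ‖u‖ ^ 2) * ‖z‖ := by
    refine (abs_le_of_sq_le_sq' ?_ (by positivity)).2
    rwa [mul_pow, Real.sq_sqrt hB]
  have h3 : 2 * (√(s - c ^ 2 - ‖u‖ ^ 2) * ‖z‖) ≤ s - c ^ 2 - ‖u‖ ^ 2 + ‖z‖ ^ 2 := by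
    have := two_mul_le_add_sq √(s - c ^ 2 - ‖u‖ ^ 2) ‖z‖
    rw [Real.sq_sqrt hB] at this
    linarith
  rw [norm_sub_sq_real]
  linarith

theorem iInf_worstCaseError_lt_top_iff [CompleteSpace F] [MeasurableSpace Y] [BorelSpace Y]
    {L : E →ₗ.[ℝ] F} (hLd : Dense (L.domain : Set E)) (H : E →L[ℝ] Y) (ℓ : E) :
    (⨅ (v : Y) (d : ℝ), worstCaseError L H {f : F | ⟪f, f⟫ ≤ 1} ℓ v d) < ∞ ↔
      ℓ ∈ sumRangeAdjoint L H := by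
  simp only [iInf_lt_iff]
  constructor
  · rintro ⟨u, c, h⟩
    have hle := (ENNReal.ofReal_toReal h.ne).ge
    obtain ⟨z, hz⟩ := exists_adjoint_eq_of_inner_le hLd fun φ =>
      Real.abs_le_sqrt (inner_sq_le_of_worstCaseError_le ENNReal.toReal_nonneg hle φ) |>.trans_eq
        (by rw [Real.sqrt_mul' _ (sq_nonneg _), Real.sqrt_sq (norm_nonneg _)])
    exact ⟨z, u, by rw [hz, sub_add_cancel]⟩
  · rintro ⟨z, u, rfl⟩
    refine ⟨u, 0, lt_of_le_of_lt ((worstCaseError_le_iff L H _ u 0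
      (s := ‖(z : F)‖ ^ 2 + ‖u‖ ^ 2) (by positivity)).2 fun φ hφ => ?_) ENNReal.ofReal_lt_top⟩
    rw [add_sub_cancel_right, sub_zero, LinearPMap.adjoint_isFormalAdjoint hLd z φ]
    have h1 : |⟪(z : F), L φ⟫| ≤ ‖(z : F)‖ :=
      (abs_real_inner_le_norm _ _).trans (mul_le_of_le_one_right (norm_nonneg _) hφ)
    have := pow_le_pow_left₀ (abs_nonneg _) h1 2
    rw [sq_abs] at this
    linarith

theorem IsEulerSolution.iInf_worstCaseError_eq [MeasurableSpace Y] [BorelSpace Y]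
    {L : E →ₗ.[ℝ] F} (hLd : Dense (L.domain : Set E))
    {H : E →L[ℝ] Y} {ℓ : E} {z : F} {p : E} (h : IsEulerSolution L H ℓ z p) :
    (⨅ (v : Y) (d : ℝ), worstCaseError L H {f : F | ⟪f, f⟫ ≤ 1} ℓ v d)
      = ENNReal.ofReal ⟪ℓ, p⟫ := by
  refine le_antisymm ((iInf₂_le (H p) 0).trans (h.worstCaseError_le hLd))
    (le_iInf₂ fun v d => ?_)
  by_cases htop : worstCaseError L H {f : F | ⟪f, f⟫ ≤ 1} ℓ v d = ∞
  · rw [htop]; exact le_top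
  have := h.le_of_worstCaseError_le hLd ENNReal.toReal_nonneg (ENNReal.ofReal_toReal htop).ge
  rw [← ENNReal.ofReal_toReal htop]
  exact ENNReal.ofReal_le_ofReal (by nlinarith [sq_nonneg ‖v - H p‖, sq_nonneg d])

theorem IsEulerSolution.isMinimaxEstimate_iff [MeasurableSpace Y] [BorelSpace Y]
    {L : E →ₗ.[ℝ] F} (hLd : Dense (L.domain : Set E))
    {H : E →L[ℝ] Y} {ℓ : E} {z : F} {p : E} (h : IsEulerSolution L H ℓ z p) (u : Y) (c : ℝ) :
    IsMinimaxEstimate L H {f : F | ⟪f, f⟫ ≤ 1} ℓ u c ↔ u = H p ∧ c = 0 := by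
  have hinf := h.iInf_worstCaseError_eq hLd
  rw [IsMinimaxEstimate, hinf]
  constructor
  · intro hu
    have hnn : 0 ≤ ⟪ℓ, p⟫ := by rw [h.inner_self_eq hLd]; positivity
    have := h.le_of_worstCaseError_le hLd hnn hu.le
    have h1 : ‖u - H p‖ ^ 2 = 0 := by nlinarith [sq_nonneg ‖u - H p‖, sq_nonneg c]
    have h2 : c ^ 2 = 0 := by nlinarith [sq_nonneg ‖u - H p‖, sq_nonneg c]
    exact ⟨sub_eq_zero.1 (norm_eq_zero.1 (pow_eq_zero_iff two_ne_zero |>.1 h1)),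
      pow_eq_zero_iff two_ne_zero |>.1 h2⟩
  · rintro ⟨rfl, rfl⟩
    exact le_antisymm (h.worstCaseError_le hLd) (hinf.ge.trans (iInf₂_le _ _))

end Estimation

end MinimaxEstimation

theorem mainTheorem2 {E F Y : Type*}
    [NormedAddCommGroup E] [InnerProductSpace ℝ E] [CompleteSpace E]
    [NormedAddCommGroup F] [InnerProductSpace ℝ F] [CompleteSpace F]
    [NormedAddCommGroup Y] [InnerProductSpace ℝ Y] [CompleteSpace Y]
    [MeasurableSpace Y] [BorelSpace Y]
    (L : E →ₗ.[ℝ] F) (hLc : L.IsClosed) (hLd : Dense (L.domain : Set E))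
    (H : E →L[ℝ] Y)
    (hR : (IsClosed (MinimaxEstimation.rangeL L) ∧ IsClosed (MinimaxEstimation.imageKer L H)) ∨
      IsClosed (MinimaxEstimation.rangeT L H))
    (G : Set F) (hG : G = {f : F | ⟪f, f⟫ ≤ 1}) (ℓ : E) :
    (MinimaxEstimation.minimaxError L H G ℓ < ∞ ↔
      ℓ ∈ MinimaxEstimation.sumRangeAdjoint L H) ∧
    ((∃! e : Y × ℝ, MinimaxEstimation.IsMinimaxEstimate L H G ℓ e.1 e.2) ↔
      ℓ ∈ MinimaxEstimation.sumRangeAdjoint L H) ∧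
    ((∃ (z : F) (p : E), MinimaxEstimation.IsEulerSolution L H ℓ z p) ↔
      ℓ ∈ MinimaxEstimation.sumRangeAdjoint L H) ∧
    (∀ (z : F) (p : E), MinimaxEstimation.IsEulerSolution L H ℓ z p →
      (∀ (u : Y) (c : ℝ),
        MinimaxEstimation.IsMinimaxEstimate L H G ℓ u c ↔ u = H p ∧ c = 0) ∧
      0 ≤ ⟪ℓ, p⟫ ∧
      MinimaxEstimation.minimaxError L H G ℓ = ENNReal.ofReal (Real.sqrt ⟪ℓ, p⟫)) := by
  subst hG
  have hT : IsClosed (MinimaxEstimation.rangeT L H) := hR.elim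
    (fun h => MinimaxEstimation.isClosed_rangeT_of_isClosed_rangeL hLc H h.1 h.2) id
  have hfin := MinimaxEstimation.iInf_worstCaseError_lt_top_iff hLd H ℓ
  refine ⟨?_, ⟨fun hex => ?_, fun hℓ => ?_⟩, ⟨fun ⟨z, p, h⟩ => h.mem_sumRangeAdjoint,
    MinimaxEstimation.exists_isEulerSolution_of_mem_sumRangeAdjoint hLd hT⟩, fun z p h =>
    ⟨h.isMinimaxEstimate_iff hLd, ?_, ?_⟩⟩
  · rw [MinimaxEstimation.minimaxError, ENNReal.rpow_lt_top_iff_of_pos (by norm_num), hfin]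
  -- If the infimum is infinite, every estimate is minimax, which contradicts uniqueness.
  · by_contra hℓ
    rw [← hfin, not_lt_top_iff] at hℓ
    have hall (e : Y × ℝ) :
        MinimaxEstimation.IsMinimaxEstimate L H {f : F | ⟪f, f⟫ ≤ 1} ℓ e.1 e.2 := by
      rw [MinimaxEstimation.IsMinimaxEstimate, hℓ, ← top_le_iff, ← hℓ]
      exact iInf₂_le _ _
    exact zero_ne_one (congrArg Prod.snd (hex.unique (hall (0, 0)) (hall (0, 1))))
  · obtain ⟨z, p, h⟩ :=
      MinimaxEstimation.exists_isEulerSolution_of_mem_sumRangeAdjoint hLd hT hℓ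
    exact ⟨(H p, 0), (h.isMinimaxEstimate_iff hLd _ _).2 ⟨rfl, rfl⟩, fun e he =>
      Prod.ext_iff.2 ((h.isMinimaxEstimate_iff hLd _ _).1 he)⟩
  · rw [h.inner_self_eq hLd]
    positivity
  · have hnn : 0 ≤ ⟪ℓ, p⟫ := by
      rw [h.inner_self_eq hLd]
      positivity
    rw [MinimaxEstimation.minimaxError, h.iInf_worstCaseError_eq hLd,
      ENNReal.ofReal_rpow_of_nonneg hnn (by norm_num), Real.sqrt_eq_rpow]
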